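/- Let $\Bbbk$ be an algebraically closed field and let $A$ be a finite-dimensional basic $\Bbbk$-algebra with a complete set $\{e_\lambda\}_{\lambda\in\Lambda}$ of orthogonal primitive idempotents ($\Lambda$ finite, $\sum_{\lambda}e_\lambda=1$; basic means that the left modules $P_\lambda=Ae_\lambda$ are pairwise non-isomorphic). All modules are finitely generated left modules; put $S_\lambda=P_\lambda/\operatorname{rad}P_\lambda$. For a linear order $\preccurlyeq$ on $\Lambda$, the algebra $A$ is called standardly stratified with respect to $\preccurlyeq$ if there are $A$-modules $D_\lambda$ ($\lambda\in\Lambda$) such that (1) the composition factor multiplicity $[D_\lambda:S_\mu]$ is $0$ whenever $\mu\not\preccurlyeq\lambda$, and (2) for every $\lambda\in\Lambda$ there is a short exact sequence $0\to K_\lambda\to P_\lambda\to D_\lambda\to 0$ in which $K_\lambda$ has a finite filtration with factors isomorphic to modules $D_\mu$ with $\mu\succ\lambda$. The standard module ${}_{\preccurlyeq}\Delta_\lambda$ is the largest quotient of $P_\lambda$ all of whose composition factors $S_\mu$ satisfy $\mu\preccurlyeq\lambda$, and $\mathcal{F}({}_{\preccurlyeq}\Delta)$ is the full subcategory of the category of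 finitely generated left $A$-modules whose objects have a finite filtration with factors isomorphic to standard modules ${}_{\preccurlyeq}\Delta_\lambda$. It is closed under cokernels of monomorphisms if for every exact sequence $0\to L\to M\to N\to 0$ with $L,M\in\mathcal{F}({}_{\preccurlyeq}\Delta)$ also $N\in\mathcal{F}({}_{\preccurlyeq}\Delta)$. If $A$ is standardly stratified with respect to two linear orders $\preccurlyeq$ and $\preccurlyeq'$ on $\Lambda$, and both $\mathcal{F}({}_{\preccurlyeq}\Delta)$ and $\mathcal{F}({}_{\preccurlyeq'}\Delta)$ are closed under cokernels of monomorphisms, then $\mathcal{F}({}_{\preccurlyeq}\Delta)=\mathcal{F}({}_{\preccurlyeq'}\Delta)$. -/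

import Mathlib

open CategoryTheory

universe u v w

namespace Stratified

/-- An idempotent is primitive if it is nonzero and is not the sum of two nonzero orthogonal
idempotents. -/
structure IsPrimitiveIdempotent {A : Type u} [Ring A] (e : A) : Prop where
  idem : IsIdempotentElem e
  ne_zero : e ≠ 0
  indecomposable : ∀ f g : A, IsIdempotentElem f → IsIdempotentElem g →
    f * g = 0 → g * f = 0 → e = f + g → f = 0 ∨ g = 0

section Modules

variable {A : Type u} [Ring A] {Λ : Type w}

/-- The left module `A e`. -/
abbrev proj (e : A) : Submodule A A := Submodule.span A {e}

/-- The top `A e / rad (A e)` of `A e`, where the radical of a module is the intersection of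
its maximal submodules. -/
abbrev simpleTop (e : A) : Type u := proj e ⧸ Module.jacobson A (proj e)

/-- The module `S` is isomorphic to a factor of a composition series of `M`
(that is, the multiplicity `[M : S]` is nonzero). -/
def IsCompositionFactor (A : Type u) [Ring A] (S : Type u) [AddCommGroup S] [Module A S]
    (M : Type v) [AddCommGroup M] [Module A M] : Prop :=
  ∃ s : CompositionSeries (Submodule A M), s.head = ⊥ ∧ s.last = ⊤ ∧
    ∃ i : Fin s.length,
      Nonempty ((s i.succ ⧸ (s i.castSucc).submoduleOf (s i.succ)) ≃ₗ[A] S)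

/-- `M` has a finite filtration `0 = F₀ ≤ F₁ ≤ ⋯ ≤ Fₙ = M` each of whose factors is isomorphic
to `D μ` for some `μ` in `T`. -/
def HasFiltration (D : Λ → ModuleCat.{u} A) (T : Set Λ)
    (M : Type v) [AddCommGroup M] [Module A M] : Prop :=
  ∃ (n : ℕ) (F : Fin (n + 1) → Submodule A M), F 0 = ⊥ ∧ F (Fin.last n) = ⊤ ∧
    ∀ i : Fin n, F i.castSucc ≤ F i.succ ∧
      ∃ μ ∈ T, Nonempty ((F i.succ ⧸ (F i.castSucc).submoduleOf (F i.succ)) ≃ₗ[A] D μ)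

/-- `A` is standardly stratified for the linear order `o` on the index set of the idempotents `e`:
there are modules `Δ l` such that
(1) `[Δ l : S m] = 0` unless `m ≼ l`, and
(2) `Δ l` is a quotient of `P l = A (e l)` by a submodule that has a filtration with factors `Δ m`,
`m ≻ l`. -/
def IsStandardlyStratified (e : Λ → A) (o : LinearOrder Λ) : Prop :=
  ∃ Δ : Λ → ModuleCat.{u} A,
    (∀ l m : Λ, ¬ o.le m l → ¬ IsCompositionFactor A (simpleTop (e m)) (Δ l)) ∧
    (∀ l : Λ, ∃ p : proj (e l) →ₗ[A] Δ l, Function.Surjective p ∧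
      HasFiltration Δ {m | o.lt l m} (LinearMap.ker p))

/-- The smallest submodule `N` of `P l = A (e l)` such that all composition factors `S m` of
`P l / N` satisfy `m ≼ l`. -/
def standardKernel (e : Λ → A) (o : LinearOrder Λ) (l : Λ) : Submodule A (proj (e l)) :=
  sInf {N | ∀ m : Λ, IsCompositionFactor A (simpleTop (e m)) (proj (e l) ⧸ N) → o.le m l}

/-- The standard module: the largest quotient of `P l` all of whose composition factors `S m`
satisfy `m ≼ l`. -/
def standardModule (e : Λ → A) (o : LinearOrder Λ) (l : Λ) : ModuleCat.{u} A :=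
  ModuleCat.of A (proj (e l) ⧸ standardKernel e o l)

/-- The full subcategory of the category of finitely generated left `A`-modules whose objects have
a filtration by standard modules. -/
def standardlyFiltered (e : Λ → A) (o : LinearOrder Λ) : ObjectProperty (ModuleCat.{u} A) :=
  fun M => Module.Finite A M ∧ HasFiltration (standardModule e o) Set.univ M

/-- A full subcategory is closed under cokernels of monomorphisms: if `0 → L → M → N → 0` is exact
and `L`, `M` belong to it, then so does `N`. -/
def ClosedUnderCokernelsOfMonos (C : ObjectProperty (ModuleCat.{u} A)) : Prop :=
  ∀ S : ShortComplex (ModuleCat.{u} A), S.ShortExact → C S.X₁ → C S.X₂ → C S.X₃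

end Modules

end Stratified

/-! By symmetry one inclusion suffices, and since filtrations can be refined, it is enough that
every standard module Δ' l for `o'` lies in F(Δ). In 0 → K' l → P l → Δ' l → 0 the middle term lies
in F(Δ) because A is stratified for `o`. The kernel is filtered by Δ' m with m larger for `o'`, so
it lies in F(Δ) by downward induction; closure under cokernels then gives Δ' l.

The filtration of K' l requires the modules D l in the definition of a stratification to be the
standard ones (`IsStandardlyStratified.hasFiltration_standardKernel`). This is seen by testing
composition factors with Hom: for finitely generated X, S m occurs in X iff Hom(P m, X) ≠ 0, since P
m is projective with a unique maximal submodule. -/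

namespace Stratified

/-! ### Filtrations, extensions and refinements. -/

section Filtrations

variable {A : Type u} [Ring A] {Λ : Type w}

/-- The quotient of `V` by its submodule `U` is isomorphic to `D`. -/
def IsSubquotient {M : Type*} [AddCommGroup M] [Module A M] (U V : Submodule A M)
    (D : Type*) [AddCommGroup D] [Module A D] : Prop :=
  U ≤ V ∧ ∃ φ : V →ₗ[A] D, Function.Surjective φ ∧ LinearMap.ker φ = U.submoduleOf V

theorem isSubquotient_iff {M : Type*} [AddCommGroup M] [Module A M] {U V : Submodule A M}
    {D : Type*} [AddCommGroup D] [Module A D] :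
    IsSubquotient U V D ↔ U ≤ V ∧ Nonempty ((V ⧸ U.submoduleOf V) ≃ₗ[A] D) := by
  refine and_congr_right fun _ => ⟨?_, ?_⟩
  · rintro ⟨φ, hφ, hk⟩
    exact ⟨(Submodule.quotEquivOfEq _ _ hk.symm).trans (φ.quotKerEquivOfSurjective hφ)⟩
  · rintro ⟨i⟩
    refine ⟨i.toLinearMap ∘ₗ (U.submoduleOf V).mkQ, ?_, ?_⟩
    · exact i.surjective.comp (Submodule.mkQ_surjective _)
    · rw [LinearEquiv.ker_comp, Submodule.ker_mkQ]

theorem IsSubquotient.map {M N : Type*} [AddCommGroup M] [Module A M] [AddCommGroup N] [Module A N]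
    {U V : Submodule A M} {D : Type*} [AddCommGroup D] [Module A D] (h : IsSubquotient U V D)
    (f : M →ₗ[A] N) (hf : Function.Injective f) : IsSubquotient (U.map f) (V.map f) D := by
  obtain ⟨hle, φ, hφ, hk⟩ := h
  let i := Submodule.equivMapOfInjective f hf V
  refine ⟨Submodule.map_mono hle, φ ∘ₗ i.symm.toLinearMap, hφ.comp i.symm.surjective, ?_⟩
  ext x
  obtain ⟨y, rfl⟩ := i.surjective x
  have hy : φ y = 0 ↔ (y : M) ∈ U := by
    rw [← LinearMap.mem_ker, hk]
    rfl
  have hi : ((i y : V.map f) : N) = f y := rfl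
  simp [Submodule.submoduleOf, hy, hi, hf.eq_iff]

theorem IsSubquotient.comap {M N : Type*} [AddCommGroup M] [Module A M]
    [AddCommGroup N] [Module A N]
    {U V : Submodule A N} {D : Type*} [AddCommGroup D] [Module A D] (h : IsSubquotient U V D)
    (f : M →ₗ[A] N) (hf : Function.Surjective f) : IsSubquotient (U.comap f) (V.comap f) D := by
  obtain ⟨hle, φ, hφ, hk⟩ := h
  let g : V.comap f →ₗ[A] V := f.restrict fun _ hx => hx
  refine ⟨Submodule.comap_mono hle, φ ∘ₗ g, hφ.comp ?_, ?_⟩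
  · rintro ⟨y, hy⟩
    obtain ⟨x, rfl⟩ := hf y
    exact ⟨⟨x, hy⟩, rfl⟩
  · rw [LinearMap.ker_comp, hk]
    rfl

/-- The submodule `V` of `M` is reached from `0` by finitely many extensions by modules `D μ`,
`μ ∈ T`. -/
inductive FiltrationReaches (D : Λ → ModuleCat.{u} A) (T : Set Λ)
    {M : Type v} [AddCommGroup M] [Module A M] : Submodule A M → Prop
  | bot : FiltrationReaches D T ⊥
  | step {U V : Submodule A M} {μ : Λ} (hU : FiltrationReaches D T U) (hμ : μ ∈ T)
      (h : IsSubquotient U V (D μ)) : FiltrationReaches D T V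

variable {D : Λ → ModuleCat.{u} A} {T : Set Λ}

/-- Trades chains indexed by `Fin` for an inductive predicate, so that later arguments are
inductions on the top step. -/
theorem hasFiltration_iff {M : Type v} [AddCommGroup M] [Module A M] :
    HasFiltration D T M ↔ FiltrationReaches D T (⊤ : Submodule A M) := by
  constructor
  · rintro ⟨n, F, h0, hn, hF⟩
    rw [← hn]
    generalize Fin.last n = i
    induction i using Fin.induction with
    | zero => exact h0 ▸ .bot
    | succ i ih =>
      obtain ⟨hle, μ, hμ, hi⟩ := hF i
      exact .step ih hμ (isSubquotient_iff.2 ⟨hle, hi⟩)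
  · intro h
    unfold HasFiltration
    generalize (⊤ : Submodule A M) = V at h ⊢
    induction h with
    | bot => exact ⟨0, fun _ => ⊥, rfl, rfl, fun i => i.elim0⟩
    | @step U V μ _ hμ h ih =>
      obtain ⟨n, F, h0, hn, hF⟩ := ih
      refine ⟨n + 1, Fin.snoc F V, ?_, ?_, ?_⟩
      · rw [← Fin.castSucc_zero, Fin.snoc_castSucc, h0]
      · rw [Fin.snoc_last]
      · intro i
        induction i using Fin.lastCases with
        | last =>
          rw [Fin.succ_last, Fin.snoc_last, Fin.snoc_castSucc, hn]
          obtain ⟨hle, hi⟩ := isSubquotient_iff.1 h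
          exact ⟨hle, μ, hμ, hi⟩
        | cast i =>
          rw [Fin.succ_castSucc, Fin.snoc_castSucc, Fin.snoc_castSucc]
          exact hF i

theorem FiltrationReaches.map {M N : Type*} [AddCommGroup M] [Module A M]
    [AddCommGroup N] [Module A N] {U : Submodule A M} (h : FiltrationReaches D T U)
    (f : M →ₗ[A] N) (hf : Function.Injective f) : FiltrationReaches D T (U.map f) := by
  induction h with
  | bot => exact (Submodule.map_bot f).symm ▸ .bot
  | step _ hμ h ih => exact .step ih hμ (h.map f hf)

/-- The preimage of ⊥ is the kernel, so the pulled-back chain continues a filtration of the kernel.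
-/
theorem FiltrationReaches.comap {M N : Type*} [AddCommGroup M] [Module A M]
    [AddCommGroup N] [Module A N] {U : Submodule A N} (h : FiltrationReaches D T U)
    (f : M →ₗ[A] N) (hf : Function.Surjective f)
    (hk : FiltrationReaches D T (LinearMap.ker f)) : FiltrationReaches D T (U.comap f) := by
  induction h with
  | bot => exact hk
  | step _ hμ h ih => exact .step ih hμ (h.comap f hf)

/-- Modules with a filtration are closed under extensions. -/
theorem HasFiltration.of_ker {M N : Type*} [AddCommGroup M] [Module A M]
    [AddCommGroup N] [Module A N] (f : M →ₗ[A] N) (hf : Function.Surjective f)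
    (hk : HasFiltration D T (LinearMap.ker f)) (hN : HasFiltration D T N) :
    HasFiltration D T M := by
  rw [hasFiltration_iff] at *
  have hk' := hk.map (LinearMap.ker f).subtype (Submodule.injective_subtype _)
  rw [Submodule.map_subtype_top] at hk'
  exact hN.comap f hf hk'

theorem HasFiltration.congr {M N : Type*} [AddCommGroup M] [Module A M]
    [AddCommGroup N] [Module A N] (i : M ≃ₗ[A] N) (h : HasFiltration D T M) :
    HasFiltration D T N := by
  rw [hasFiltration_iff] at *
  simpa using h.map i.toLinearMap i.injective

theorem HasFiltration.self {μ : Λ} (hμ : μ ∈ T) : HasFiltration D T (D μ) := by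
  rw [hasFiltration_iff]
  refine .step .bot hμ ⟨bot_le, Submodule.topEquiv.toLinearMap, Submodule.topEquiv.surjective, ?_⟩
  rw [LinearEquiv.ker]
  ext x
  simp [Submodule.submoduleOf]

/-- A module filtered by modules that are themselves filtered is filtered. -/
theorem HasFiltration.trans {D' : Λ → ModuleCat.{u} A} {T' : Set Λ}
    (hD : ∀ μ ∈ T, HasFiltration D' T' (D μ)) {M : Type v} [AddCommGroup M] [Module A M]
    (h : HasFiltration D T M) : HasFiltration D' T' M := by
  rw [hasFiltration_iff] at h
  suffices ∀ V : Submodule A M, FiltrationReaches D T V → HasFiltration D' T' V from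
    (this _ h).congr Submodule.topEquiv
  intro V hV
  induction hV with
  | bot => exact ⟨0, fun _ => ⊥, rfl, Subsingleton.elim _ _, fun i => i.elim0⟩
  | step hU hμ h ih =>
    obtain ⟨hle, φ, hφ, hk⟩ := h
    refine .of_ker φ hφ ?_ (hD _ hμ)
    rw [hk]
    exact ih.congr (Submodule.submoduleOfEquivOfLe hle).symm

/-- A homomorphism out of a filtered module vanishes if there are no nonzero homomorphisms out
of the factors of the filtration. -/
theorem HasFiltration.hom_eq_zero {M : Type v} [AddCommGroup M] [Module A M]
    (h : HasFiltration D T M) {X : Type*} [AddCommGroup X] [Module A X]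
    (hX : ∀ μ ∈ T, ∀ f : D μ →ₗ[A] X, f = 0) (f : M →ₗ[A] X) : f = 0 := by
  rw [hasFiltration_iff] at h
  rw [← LinearMap.ker_eq_top, eq_top_iff]
  generalize (⊤ : Submodule A M) = V at h
  induction h with
  | bot => exact bot_le
  | @step U V μ _ hμ h ih =>
    obtain ⟨i⟩ := (isSubquotient_iff.1 h).2
    -- As `f` kills U by induction, its restriction to V factors through V/U ≅ D μ.
    let g : (V ⧸ U.submoduleOf V) →ₗ[A] X :=
      (U.submoduleOf V).liftQ (f ∘ₗ V.subtype) fun x hx => ih hx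
    have hg : g ∘ₗ i.symm.toLinearMap = 0 := hX μ hμ _
    intro x hx
    have hx' := LinearMap.congr_fun hg (i ((U.submoduleOf V).mkQ ⟨x, hx⟩))
    rw [LinearMap.comp_apply, LinearEquiv.coe_coe, i.symm_apply_apply] at hx'
    exact hx'

end Filtrations

/-! ### Indecomposable projectives and composition factors. -/

section Projectives

variable {A : Type u} [Ring A]

theorem IsPrimitiveIdempotent.nontrivial_proj {e : A} (he : IsPrimitiveIdempotent e) :
    Nontrivial (proj e) :=
  Submodule.nontrivial_iff_ne_bot.2 fun h => he.ne_zero (Submodule.span_singleton_eq_bot.1 h)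

theorem mul_eq_self_of_mem_proj {e : A} (he : IsIdempotentElem e) {x : A} (hx : x ∈ proj e) :
    x * e = x := by
  obtain ⟨a, rfl⟩ := Submodule.mem_span_singleton.1 hx
  rw [smul_eq_mul, mul_assoc, he.eq]

/-- Right multiplication by `e` retracts A onto A e. -/
theorem projective_proj {e : A} (he : IsIdempotentElem e) : Module.Projective A (proj e) := by
  refine Module.Projective.of_split (proj e).subtype
    ((LinearMap.toSpanSingleton A A e).codRestrict (proj e) fun a =>
      Submodule.smul_mem _ a (Submodule.mem_span_singleton_self e)) ?_
  ext x
  exact mul_eq_self_of_mem_proj he x.2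

/-- The module generated by a primitive idempotent is indecomposable. -/
theorem IsPrimitiveIdempotent.eq_top_or_eq_top {e : A} (he : IsPrimitiveIdempotent e)
    {U V : Submodule A (proj e)} (h : IsCompl U V) : U = ⊤ ∨ V = ⊤ := by
  have top_of_mem : ∀ W : Submodule A (proj e),
      (⟨e, Submodule.mem_span_singleton_self e⟩ : proj e) ∈ W → W = ⊤ := by
    intro W hW
    rw [eq_top_iff]
    rintro ⟨x, hx⟩ -
    obtain ⟨a, rfl⟩ := Submodule.mem_span_singleton.1 hx
    exact W.smul_mem a hW
  obtain ⟨u, hu, v, hv, huv⟩ := Submodule.mem_sup.1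
    (h.sup_eq_top ▸ Submodule.mem_top :
      (⟨e, Submodule.mem_span_singleton_self e⟩ : proj e) ∈ U ⊔ V)
  have huv' : (u : A) + v = e := congrArg Subtype.val huv
  have key : ∀ x y x' y' : proj e, x ∈ U → y ∈ V → x' ∈ U → y' ∈ V → x + y = x' + y' →
      x = x' ∧ y = y' := by
    intro x y x' y' hx hy hx' hy' hxy
    have hd : x - x' = y' - y := by rw [sub_eq_sub_iff_add_eq_add, hxy, add_comm]
    have h0 : x - x' = 0 := (Submodule.disjoint_def.1 h.disjoint) _ (U.sub_mem hx hx')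
      (hd ▸ V.sub_mem hy' hy)
    exact ⟨sub_eq_zero.1 h0, (sub_eq_zero.1 (hd ▸ h0)).symm⟩
  have hue := mul_eq_self_of_mem_proj he.idem u.2
  have hve := mul_eq_self_of_mem_proj he.idem v.2
  -- Compare u = u e = u u + u v with u = u + 0 in U ⊕ V: u u = u and u v = 0. The same for v makes
  -- u, v orthogonal idempotents with sum `e`.
  obtain ⟨h1, h2⟩ := key ((u : A) • u) ((u : A) • v) u 0 (U.smul_mem _ hu) (V.smul_mem _ hv) hu
    V.zero_mem (Subtype.ext (by simpa [← mul_add, huv'] using hue))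
  obtain ⟨h3, h4⟩ := key ((v : A) • u) ((v : A) • v) 0 v (U.smul_mem _ hu) (V.smul_mem _ hv)
    U.zero_mem hv (Subtype.ext (by simpa [← mul_add, huv'] using hve))
  rcases he.indecomposable u v (congrArg Subtype.val h1) (congrArg Subtype.val h4)
    (congrArg Subtype.val h2) (congrArg Subtype.val h3) huv'.symm with h | h
  · right
    apply top_of_mem
    rw [← huv, Subtype.ext (a2 := (0 : proj e)) h, zero_add]
    exact hv
  · left
    apply top_of_mem
    rw [← huv, Subtype.ext (a2 := (0 : proj e)) h, add_zero]
    exact hu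

/-- A subquotient of a module of finite length that is simple is a composition factor. -/
theorem isCompositionFactor_of_covBy {M : Type v} [AddCommGroup M] [Module A M]
    [IsArtinian A M] [IsNoetherian A M] {U V : Submodule A M} (hUV : U ⋖ V)
    {S : Type u} [AddCommGroup S] [Module A S] (h : IsSubquotient U V S) :
    IsCompositionFactor A S M := by
  obtain ⟨a, ha0, n, han, ha⟩ :=
    exists_covBy_seq_of_wellFoundedLT_wellFoundedGT_of_le (bot_le : ⊥ ≤ U)
  obtain ⟨b, hb0, m, hbm, hb⟩ :=
    exists_covBy_seq_of_wellFoundedLT_wellFoundedGT_of_le (le_top : V ≤ ⊤)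
  -- Concatenates the chains below U and above V; U and V sit at positions n and n + 1.
  let t : ℕ → Submodule A M := fun i => if i ≤ n then a i else b (i - (n + 1))
  have ht : ∀ i < n + 1 + m, t i ⋖ t (i + 1) := by
    intro i hi
    rcases lt_trichotomy i n with h | rfl | h
    · simpa [t, h.le, Nat.succ_le_of_lt h] using ha i h
    · simpa [t, han, hb0] using hUV
    · have h1 : i + 1 - (n + 1) = i - (n + 1) + 1 := by omega
      have h2 : ¬ i + 1 ≤ n := by omega
      simpa [t, h.not_ge, h2, h1] using hb (i - (n + 1)) (by omega)
  refine ⟨⟨n + 1 + m, fun i => t i, fun i => ht i i.2⟩, ?_, ?_, ⟨n, by simp; omega⟩, ?_⟩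
  · change t 0 = ⊥
    simp [t, ha0]
  · change t (n + 1 + m) = ⊤
    have : ¬ n + 1 + m ≤ n := by omega
    simp [t, this, hbm]
  · have h1 : t n = U := by simp [t, han]
    have h2 : t (n + 1) = V := by simp [t, hb0]
    change Nonempty ((t (n + 1) ⧸ (t n).submoduleOf (t (n + 1))) ≃ₗ[A] S)
    rw [h1, h2]
    exact (isSubquotient_iff.1 h).2

variable [IsArtinianRing A]

/-- Over an Artinian ring, the module generated by a primitive idempotent has at most one maximal
submodule. -/
theorem IsPrimitiveIdempotent.isCoatom_unique {e : A} (he : IsPrimitiveIdempotent e)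
    {M N : Submodule A (proj e)} (hM : IsCoatom M) (hN : IsCoatom N) : M = N := by
  by_contra hne
  have hsup : M ⊔ N = ⊤ := hM.sup_eq_top_of_ne hN hne
  have := projective_proj he.idem
  have hsurj : Function.Surjective (M.mkQ ∘ₗ N.subtype) := by
    rw [← LinearMap.range_eq_top, LinearMap.range_comp, Submodule.range_subtype,
      ← (Submodule.map_mkQ_eq_top _ _).2 hsup]
  -- Lifting P → P/M through N gives an endomorphism with image in N that is the identity modulo M.
  obtain ⟨g, hg⟩ := Module.projective_lifting_property _ M.mkQ hsurj
  let φ : Module.End A (proj e) := N.subtype ∘ₗ g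
  have hφ : M.mkQ ∘ₗ φ = M.mkQ := hg
  have hφn : ∀ n : ℕ, M.mkQ ∘ₗ (φ ^ n) = M.mkQ := by
    intro n
    induction n with
    | zero => rfl
    | succ n ih => rw [pow_succ, Module.End.mul_eq_comp, ← LinearMap.comp_assoc, ih, hφ]
  -- Fitting's lemma: a high power of `φ` is zero, forcing M = ⊤, or surjective, forcing N = ⊤. The
  -- exponent n + 1 ensures a factor `φ`, hence image in N.
  obtain ⟨n, hn⟩ := Filter.eventually_atTop.1 φ.eventually_isCompl_ker_pow_range_pow
  rcases he.eq_top_or_eq_top (hn (n + 1) n.le_succ) with h | h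
  · have h1 := hφn (n + 1)
    rw [LinearMap.ker_eq_top.1 h, LinearMap.comp_zero] at h1
    apply hM.1
    rw [← M.ker_mkQ, ← h1, LinearMap.ker_zero]
  · apply hN.1
    rw [eq_top_iff, ← h, pow_succ', Module.End.mul_eq_comp]
    refine (LinearMap.range_comp_le_range _ _).trans ((LinearMap.range_comp_le_range _ _).trans ?_)
    rw [Submodule.range_subtype]

theorem IsPrimitiveIdempotent.eq_jacobson {e : A} (he : IsPrimitiveIdempotent e)
    {M : Submodule A (proj e)} (hM : IsCoatom M) : M = Module.jacobson A (proj e) := by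
  refine le_antisymm ?_ (sInf_le hM)
  exact le_sInf fun N hN => (he.isCoatom_unique hM hN).le

/-- The simple top of `A e` is a composition factor of `X` if and only if there is a nonzero
homomorphism from `A e` to `X`. -/
theorem IsPrimitiveIdempotent.isCompositionFactor_iff {e : A} (he : IsPrimitiveIdempotent e)
    {X : Type v} [AddCommGroup X] [Module A X] [Module.Finite A X] :
    IsCompositionFactor A (simpleTop e) X ↔ ∃ f : proj e →ₗ[A] X, f ≠ 0 := by
  have := he.nontrivial_proj
  constructor
  · rintro ⟨s, -, -, i, ⟨j⟩⟩
    have := projective_proj he.idem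
    obtain ⟨g, hg⟩ := Module.projective_lifting_property
      (j.toLinearMap ∘ₗ ((s i.castSucc).submoduleOf (s i.succ)).mkQ)
      (Module.jacobson A (proj e)).mkQ (j.surjective.comp (Submodule.mkQ_surjective _))
    refine ⟨(s i.succ).subtype ∘ₗ g, fun h => ?_⟩
    have hg0 : g = 0 := by
      ext x
      exact LinearMap.congr_fun h x
    rw [hg0, LinearMap.comp_zero] at hg
    apply (Module.jacobson_lt_top A (proj e)).ne
    rw [← (Module.jacobson A (proj e)).ker_mkQ, ← hg, LinearMap.ker_zero]
  · rintro ⟨f, hf⟩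
    have hk : LinearMap.ker f ≠ ⊤ := fun h => hf (LinearMap.ker_eq_top.1 h)
    -- M is the radical and contains ker f, so f(P)/f(M) ≅ P/M is the simple top.
    obtain ⟨M, hM, hfM⟩ := (eq_top_or_exists_le_coatom (LinearMap.ker f)).resolve_left hk
    have hMJ := he.eq_jacobson hM
    have hcomap : (M.map f).comap f = M := by
      rw [Submodule.comap_map_eq, sup_eq_left.2 hfM]
    have hle : M.map f ≤ LinearMap.range f := LinearMap.map_le_range
    let φ : (proj e) →ₗ[A] LinearMap.range f ⧸ (M.map f).submoduleOf (LinearMap.range f) :=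
      Submodule.mkQ _ ∘ₗ f.rangeRestrict
    have hφ : Function.Surjective φ :=
      (Submodule.mkQ_surjective _).comp f.surjective_rangeRestrict
    have hkφ : LinearMap.ker φ = Module.jacobson A (proj e) := by
      rw [LinearMap.ker_comp, Submodule.ker_mkQ, ← hMJ]
      exact hcomap
    let i : simpleTop e ≃ₗ[A] LinearMap.range f ⧸ (M.map f).submoduleOf (LinearMap.range f) :=
      (Submodule.quotEquivOfEq _ _ hkφ.symm).trans (φ.quotKerEquivOfSurjective hφ)
    refine isCompositionFactor_of_covBy (U := M.map f) (V := LinearMap.range f) ?_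
      (isSubquotient_iff.2 ⟨hle, ⟨i.symm⟩⟩)
    rw [covBy_iff_quot_is_simple hle]
    have : IsSimpleModule A (simpleTop e) := isSimpleModule_iff_isCoatom.2 (hMJ ▸ hM)
    exact IsSimpleModule.congr i.symm

end Projectives

/-! ### Standard modules and comparison of two stratifications. -/

section Standard

variable {A : Type u} [Ring A] [IsArtinianRing A] {Λ : Type w} {e : Λ → A} {o o' : LinearOrder Λ}

/-- In a standardly stratified algebra, the kernel of the projection of `P l` onto the standard
module has a filtration by standard modules of larger index. -/
theorem IsStandardlyStratified.hasFiltration_standardKernel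
    (hprim : ∀ l, IsPrimitiveIdempotent (e l)) (hs : IsStandardlyStratified e o) (l : Λ) :
    HasFiltration (standardModule e o) {m | o.lt l m} (standardKernel e o l) := by
  obtain ⟨D, hD, hp⟩ := hs
  choose p hsurj hfil using hp
  have hker : ∀ l, standardKernel e o l = LinearMap.ker (p l) := by
    intro l
    have : Module.Finite A (D l) := Module.Finite.of_surjective (p l) (hsurj l)
    apply le_antisymm
    · refine sInf_le fun m hm => ?_
      by_contra hml
      apply hD l m hml
      rw [(hprim m).isCompositionFactor_iff] at hm ⊢
      obtain ⟨f, hf⟩ := hm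
      refine ⟨((p l).quotKerEquivOfSurjective (hsurj l)).toLinearMap ∘ₗ f, fun h => hf ?_⟩
      ext x
      exact ((p l).quotKerEquivOfSurjective (hsurj l)).injective
        ((LinearMap.congr_fun h x).trans (map_zero _).symm)
    · refine le_sInf fun N hN => ?_
      -- A nonzero map D m → P l / N with m ≻ l, composed with P m ↠ D m, would make S m a
      -- composition factor of P l / N, forcing m ≼ l.
      have h0 : N.mkQ ∘ₗ (LinearMap.ker (p l)).subtype = 0 := by
        refine (hfil l).hom_eq_zero (fun m hm f => ?_) _
        by_contra hf
        have hle := hN m ((hprim m).isCompositionFactor_iff.2 ⟨f ∘ₗ p m, fun h => hf ?_⟩)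
        · exact absurd (o.lt_iff_le_not_ge l m |>.1 hm).2 (not_not.2 hle)
        · rw [← LinearMap.cancel_right (hsurj m), h, LinearMap.zero_comp]
      intro x hx
      rw [← N.ker_mkQ]
      exact LinearMap.congr_fun h0 ⟨x, hx⟩
  rw [hker l]
  refine (hfil l).trans fun m hm => ?_
  refine (HasFiltration.self (D := standardModule e o) (μ := m) hm).congr ?_
  exact (Submodule.quotEquivOfEq _ _ (hker m)).trans ((p m).quotKerEquivOfSurjective (hsurj m))

/-- In a standardly stratified algebra, the modules `P l` have a filtration by standard modules. -/
theorem IsStandardlyStratified.hasFiltration_proj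
    (hprim : ∀ l, IsPrimitiveIdempotent (e l)) (hs : IsStandardlyStratified e o) (l : Λ) :
    HasFiltration (standardModule e o) Set.univ (proj (e l)) := by
  refine .of_ker (standardKernel e o l).mkQ (Submodule.mkQ_surjective _) ?_
    (HasFiltration.self (D := standardModule e o) (Set.mem_univ l))
  rw [Submodule.ker_mkQ]
  exact (hs.hasFiltration_standardKernel hprim l).trans fun m _ => .self (Set.mem_univ m)

/-- If the category of modules filtered by the standard modules of one stratification is closed
under cokernels of monomorphisms, then it contains the corresponding category of any other
stratification. -/
theorem standardlyFiltered_le [Finite Λ] (hprim : ∀ l, IsPrimitiveIdempotent (e l))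
    (hs : IsStandardlyStratified e o) (hs' : IsStandardlyStratified e o')
    (hc : ClosedUnderCokernelsOfMonos (standardlyFiltered e o)) :
    standardlyFiltered e o' ≤ standardlyFiltered e o := by
  have hstd : ∀ l, HasFiltration (standardModule e o) Set.univ (standardModule e o' l) := by
    intro l
    -- Λ is finite, so induction can run downwards from the `o'`-maximal index.
    have hwf : WellFounded (fun a b : Λ => o'.lt b a) :=
      (@Finite.to_wellFoundedGT Λ _ o'.toPreorder).wf
    induction l using hwf.induction with
    | h l ih =>
      let K := standardKernel e o' l
      have hK : HasFiltration (standardModule e o) Set.univ K :=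
        (hs'.hasFiltration_standardKernel hprim l).trans ih
      let S : ShortComplex (ModuleCat.{u} A) :=
        ShortComplex.mk (ModuleCat.ofHom K.subtype) (ModuleCat.ofHom K.mkQ) (by
          ext x
          simp)
      have hS : S.ShortExact := by
        refine ModuleCat.shortComplex_shortExact S ?_ (Submodule.injective_subtype _)
          (Submodule.mkQ_surjective _)
        exact LinearMap.exact_subtype_mkQ K
      exact (hc S hS ⟨(inferInstance : Module.Finite A K), hK⟩
        ⟨(inferInstance : Module.Finite A (proj (e l))), hs.hasFiltration_proj hprim l⟩).2
  exact fun M hM => ⟨hM.1, hM.2.trans fun m _ => hstd m⟩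

end Standard

end Stratified

theorem corollary3p4 {k : Type v} [Field k] [IsAlgClosed k]
    {A : Type u} [Ring A] [Algebra k A] [FiniteDimensional k A]
    {Λ : Type w} [Fintype Λ] (e : Λ → A)
    (he : CompleteOrthogonalIdempotents e)
    (hprim : ∀ l, Stratified.IsPrimitiveIdempotent (e l))
    -- the algebra is basic
    (hbasic : ∀ l m, Nonempty (Stratified.proj (e l) ≃ₗ[A] Stratified.proj (e m)) → l = m)
    (o o' : LinearOrder Λ)
    (hs : Stratified.IsStandardlyStratified e o)
    (hs' : Stratified.IsStandardlyStratified e o')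
    (hc : Stratified.ClosedUnderCokernelsOfMonos (Stratified.standardlyFiltered e o))
    (hc' : Stratified.ClosedUnderCokernelsOfMonos (Stratified.standardlyFiltered e o')) :
    Stratified.standardlyFiltered e o = Stratified.standardlyFiltered e o' := by
  have : IsArtinianRing A := isArtinian_of_tower k inferInstance
  exact le_antisymm (Stratified.standardlyFiltered_le hprim hs' hs hc')
    (Stratified.standardlyFiltered_le hprim hs hs' hc)
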